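/- For a positive integer $m$ and a real number $p$ put $$\alpha(m)=\frac{m+2+\sqrt{m^2+4m}}{2},\qquad \beta(m)=\frac{m+2-\sqrt{m^2+4m}}{2},\qquad u_p(m)=\frac{\alpha(m)^p-\beta(m)^p}{\alpha(m)-\beta(m)},$$ and let $e_p=u_p(2)$ and $f_p=u_p(4)$. For every integer $n\ge 3$, the number of spanning trees of the Cartesian product $C_4\times C_n$ of the cycles on $4$ and on $n$ vertices is $$2^7\cdot 3^2\cdot n\cdot e_{n/2}^4\cdot f_{n/2}^2,$$ where the index $n/2$ is the real number (not rounded). Equivalently, it is $$\frac{n}{4^{n+1}}\left((\sqrt3+1)^n-(\sqrt3-1)^n\right)^4\left((\sqrt2+1)^n-(\sqrt2-1)^n\right)^2.$$ -/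

import Mathlib

/-- The number of spanning trees of a graph `G` on the vertex type `V`: a spanning tree is a graph
on all of `V`, each of whose edges is an edge of `G`, which is a tree (connected and acyclic). -/
noncomputable def numSpanningTrees {V : Type*} (G : SimpleGraph V) : ℕ :=
  {T : SimpleGraph V | T ≤ G ∧ T.IsTree}.ncard

/-- `α(m) = (m + 2 + √(m² + 4m)) / 2`. -/
noncomputable def lucasAlpha (m : ℕ) : ℝ :=
  ((m : ℝ) + 2 + Real.sqrt ((m : ℝ) ^ 2 + 4 * (m : ℝ))) / 2

/-- `β(m) = (m + 2 - √(m² + 4m)) / 2`. -/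
noncomputable def lucasBeta (m : ℕ) : ℝ :=
  ((m : ℝ) + 2 - Real.sqrt ((m : ℝ) ^ 2 + 4 * (m : ℝ))) / 2

/-- `u_p(m) = (α(m)^p - β(m)^p) / (α(m) - β(m))` for a real index `p` (with real powers; for
`m ≥ 1` both bases are positive and distinct). -/
noncomputable def lucasU (p : ℝ) (m : ℕ) : ℝ :=
  1 / (lucasAlpha m - lucasBeta m) * (lucasAlpha m ^ p - lucasBeta m ^ p)

/-- `e_p = u_p(2)`. -/
noncomputable def eSeq (p : ℝ) : ℝ := lucasU p 2

/-- `f_p = u_p(4)`. -/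
noncomputable def fSeq (p : ℝ) : ℝ := lucasU p 4

/-! The matrix-tree theorem comes from multilinearity. Row `i ≠ r` of the Laplacian is the sum of
`eᵢ - e_k` over neighbours `k`, so the reduced determinant is a sum over maps `f` choosing a
neighbour of each vertex. A map contributes 1 if its iterates carry every vertex to `r` and 0
otherwise; the contributing maps are the spanning trees oriented towards `r`.

`det_add_const` then trades the cofactor for the determinant of Laplacian plus all-ones matrix,
which respects the Kronecker structure. Diagonalising the `C₄` factor (eigenvalues 0, 4, 2, 2)
leaves determinants of `m + L` for `m = 4, 2, 2` and a corrected one for `m = 0`, where `L` is the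
Laplacian of `C_n`. With `a * b = 1` and `a + b = m + 2`, `m + L` factors through the cyclic shift
and has determinant `aⁿ + bⁿ - 2`, which is `(a^(n/2) - b^(n/2))²`. -/

open Matrix Finset
open scoped Kronecker

/-! ### Matrix-tree theorem via parent maps -/

section RootedMaps

variable {V : Type*} [Fintype V] [DecidableEq V]

/-- Every vertex is carried to `r` by some iterate of the parent map `f`. -/
def ReachesRoot {V : Type*} (f : V → V) (r : V) : Prop := ∀ i, ∃ k : ℕ, f^[k] i = r

/-- The matrix whose row at `i ≠ r` is `eᵢ - e_{f i}` and whose row at `r` is `e_r`. -/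
def parentMatrix {V : Type*} [DecidableEq V] (f : V → V) (r : V) : Matrix V V ℝ :=
  fun i => if i = r then Pi.single r 1 else Pi.single i 1 - Pi.single (f i) 1

/-- The graph joining every vertex to its image under `f`. -/
def parentGraph {V : Type*} (f : V → V) : SimpleGraph V := SimpleGraph.fromRel fun i j => f i = j

theorem parentGraph_adj {V : Type*} {f : V → V} {a b : V} :
    (parentGraph f).Adj a b ↔ a ≠ b ∧ (f a = b ∨ f b = a) :=
  SimpleGraph.fromRel_adj _ _ _

/-- Away from `r`, `f` strictly lowers the number of steps to `r`, so grading by it makes the matrix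
block triangular with identity diagonal blocks. -/
theorem det_parentMatrix_of_reachesRoot {f : V → V} {r : V} (h : ReachesRoot f r) :
    (parentMatrix f r).det = 1 := by
  classical
  let d : V → ℕ := fun i => Nat.find (h i)
  have hd : ∀ i, i ≠ r → d (f i) < d i := by
    intro i hi
    have h1 : f^[d i] i = r := Nat.find_spec (h i)
    rcases hk : d i with _ | k
    · rw [hk] at h1; exact absurd h1 hi
    · rw [hk, Function.iterate_succ_apply] at h1
      exact Nat.lt_succ_of_le (Nat.find_min' (h (f i)) h1)
  have hT : (parentMatrix f r).BlockTriangular (OrderDual.toDual ∘ d) := by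
    intro i j hij
    have hij' : d i < d j := hij
    have hne : j ≠ i := by rintro rfl; exact lt_irrefl _ hij'
    unfold parentMatrix
    by_cases hi : i = r
    · subst hi; simp [hne]
    · have hne' : j ≠ f i := by
        rintro rfl; exact lt_asymm hij' (hd i hi)
      simp [hi, hne, hne']
  rw [hT.det]
  refine prod_eq_one fun a _ => ?_
  have : (parentMatrix f r).toSquareBlock (OrderDual.toDual ∘ d) a = 1 := by
    ext ⟨i, hi⟩ ⟨j, hj⟩
    have hij : d i = d j := by
      have := hi.trans hj.symm
      exact this
    simp only [Matrix.toSquareBlock_def, Matrix.of_apply, Matrix.one_apply, Subtype.mk.injEq]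
    unfold parentMatrix
    by_cases hir : i = r
    · subst hir; simp [Pi.single_apply, eq_comm]
    · have hne' : j ≠ f i := by
        rintro rfl; exact absurd (hd i hir) (by omega)
      simp [hir, Pi.single_apply, hne', eq_comm]
  rw [this, det_one]

/-- The indicator of the vertices that never reach `r` is a nonzero kernel vector, since `i ≠ r` and
`f i` have the same status. -/
theorem det_parentMatrix_of_not_reachesRoot {f : V → V} {r : V} (h : ¬ ReachesRoot f r) :
    (parentMatrix f r).det = 0 := by
  classical
  unfold ReachesRoot at h
  push Not at h
  obtain ⟨i₀, hi₀⟩ := h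
  let x : V → ℝ := fun i => if ∃ k : ℕ, f^[k] i = r then 0 else 1
  refine exists_mulVec_eq_zero_iff.mp ⟨x, fun hx => ?_, ?_⟩
  · have := congrFun hx i₀
    simp [x, hi₀] at this
  · ext i
    unfold parentMatrix
    by_cases hi : i = r
    · subst hi
      have : ∃ k : ℕ, f^[k] i = i := ⟨0, rfl⟩
      simp [mulVec, x, this]
    · have : (∃ k : ℕ, f^[k] i = r) ↔ ∃ k : ℕ, f^[k] (f i) = r := by
        constructor
        · rintro ⟨_ | k, hk⟩
          · exact absurd hk hi
          · exact ⟨k, hk⟩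
        · rintro ⟨k, hk⟩
          exact ⟨k + 1, hk⟩
      have hrow : (fun j => (if i = r then Pi.single r 1 else Pi.single i 1 - Pi.single (f i) 1 :
          V → ℝ) j) = Pi.single i 1 - Pi.single (f i) 1 := by
        ext j; simp [hi]
      change (fun j => (if i = r then Pi.single r 1 else Pi.single i 1 - Pi.single (f i) 1 :
          V → ℝ) j) ⬝ᵥ x = 0
      rw [hrow, sub_dotProduct]
      simp [x, this]

theorem reachesRoot_apply_apply_ne {V : Type*} {f : V → V} {r i : V} (hf : ReachesRoot f r)
    (hr : f r = r) (hi : i ≠ r) : f (f i) ≠ i := by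
  intro h
  obtain ⟨k, hk⟩ := hf i
  have key : ∀ k : ℕ, f^[k] i = i ∨ f^[k] i = f i := by
    intro k
    induction k with
    | zero => exact Or.inl rfl
    | succ k ih =>
      rw [Function.iterate_succ_apply']
      rcases ih with h' | h' <;> rw [h'] <;> simp [h]
  rcases key k with h' | h'
  · exact hi (h'.symm.trans hk)
  · rw [← h', hk, hr] at h
    exact hi h.symm

theorem connected_parentGraph {V : Type*} {f : V → V} {r : V} (h : ReachesRoot f r) :
    (parentGraph f).Connected := by
  have step : ∀ i, (parentGraph f).Reachable i (f i) := by
    intro i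
    by_cases hi : i = f i
    · rw [← hi]
    · exact SimpleGraph.Adj.reachable (parentGraph_adj.mpr ⟨hi, Or.inl rfl⟩)
  have iter : ∀ k i, (parentGraph f).Reachable i (f^[k] i) := by
    intro k
    induction k with
    | zero => intro i; exact SimpleGraph.Reachable.refl _
    | succ k ih => intro i; exact (step i).trans (ih (f i))
  have root : ∀ i, (parentGraph f).Reachable i r := by
    intro i
    obtain ⟨k, hk⟩ := h i
    exact hk ▸ iter k i
  have : Nonempty V := ⟨r⟩
  exact ⟨fun a b => (root a).trans (root b).symm⟩

/-- Every edge is `s(i, f i)` with `i ≠ r`, so this connected graph has at most `|V| - 1` edges. -/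
theorem isTree_parentGraph {f : V → V} {r : V} (hr : f r = r) (h : ReachesRoot f r) :
    (parentGraph f).IsTree := by
  classical
  have hc := connected_parentGraph h
  refine SimpleGraph.isTree_iff_connected_and_card.mpr ⟨hc, ?_⟩
  refine le_antisymm ?_ hc.card_vert_le_card_edgeSet_add_one
  have hsub : (parentGraph f).edgeSet ⊆ ((univ.erase r).image fun i => s(i, f i) : Finset (Sym2 V)) := by
    intro e
    induction e using Sym2.ind with
    | _ a b =>
      rw [SimpleGraph.mem_edgeSet, parentGraph_adj]
      rintro ⟨hab, h1 | h1⟩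
      · refine mem_coe.mpr (mem_image.mpr ⟨a, ?_, by rw [h1]⟩)
        refine mem_erase.mpr ⟨?_, mem_univ _⟩
        rintro rfl; exact hab (hr.symm.trans h1)
      · refine mem_coe.mpr (mem_image.mpr ⟨b, ?_, by rw [h1, Sym2.eq_swap]⟩)
        refine mem_erase.mpr ⟨?_, mem_univ _⟩
        rintro rfl; exact hab (h1.symm.trans hr)
  have h1 : Nat.card (parentGraph f).edgeSet ≤ Fintype.card V - 1 := by
    have h2 := Set.ncard_le_ncard hsub (Finset.finite_toSet _)
    rw [Set.ncard_coe_finset] at h2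
    rw [Nat.card_coe_set_eq]
    refine h2.trans (card_image_le.trans ?_)
    rw [card_erase_of_mem (mem_univ _), card_univ]
  have : 0 < Fintype.card V := Fintype.card_pos_iff.mpr ⟨r⟩
  rw [Nat.card_eq_fintype_card (α := V)]
  omega

/-- A disagreement at `i` forces `f (g i) = i`, hence a disagreement at `g i`, as `g` has no 2-cycle
there. It would travel along the `g`-orbit to `r`, where the maps agree. -/
theorem parentGraph_injOn {V : Type*} {f g : V → V} {r : V} (hfr : f r = r) (hgr : g r = r)
    (hf : ReachesRoot f r) (hg : ReachesRoot g r) (h : parentGraph f = parentGraph g) : f = g := by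
  have hstep : ∀ i, f i ≠ g i → g i ≠ r ∧ f (g i) ≠ g (g i) := by
    intro i hi
    have hir : i ≠ r := by rintro rfl; exact hi (hfr.trans hgr.symm)
    have hgi : i ≠ g i := by
      intro h'
      have : ∀ k : ℕ, g^[k] i = i := fun k => Function.iterate_fixed h'.symm k
      obtain ⟨k, hk⟩ := hg i
      exact hir ((this k).symm.trans hk)
    have hadj : (parentGraph f).Adj i (g i) := by
      rw [h]; exact parentGraph_adj.mpr ⟨hgi, Or.inl rfl⟩
    have hfg : f (g i) = i := (parentGraph_adj.mp hadj).2.resolve_left hi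
    have hne : g i ≠ r := by
      intro h'
      rw [h', hfr] at hfg
      exact hir hfg.symm
    exact ⟨hne, by rw [hfg]; exact (reachesRoot_apply_apply_ne hg hgr hir).symm⟩
  funext i
  by_contra hi
  have key : ∀ k : ℕ, f (g^[k] i) ≠ g (g^[k] i) := by
    intro k
    induction k with
    | zero => exact hi
    | succ k ih =>
      rw [Function.iterate_succ_apply']
      exact (hstep _ ih).2
  obtain ⟨k, hk⟩ := hg i
  have := key k
  rw [hk, hfr, hgr] at this
  exact this rfl

/-- Send each vertex to a neighbour strictly closer to `r`. The resulting connected subgraph is all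
of `T`, because trees are minimal connected. -/
theorem exists_parentGraph_eq {V : Type*} {T : SimpleGraph V} (hT : T.IsTree) (r : V) :
    ∃ f : V → V, f r = r ∧ (∀ i, i ≠ r → T.Adj i (f i)) ∧ ReachesRoot f r ∧ parentGraph f = T := by
  classical
  have hex : ∀ i, i ≠ r → ∃ j, T.Adj i j ∧ T.dist j r < T.dist i r := by
    intro i hi
    obtain ⟨p, hp⟩ := hT.connected.exists_walk_length_eq_dist i r
    cases p with
    | nil => exact absurd rfl hi
    | cons hadj q =>
      refine ⟨_, hadj, ?_⟩
      rw [← hp, SimpleGraph.Walk.length_cons]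
      exact Nat.lt_succ_of_le (SimpleGraph.dist_le q)
  choose! g hg using hex
  let f : V → V := fun i => if i = r then r else g i
  have hfr : f r = r := by simp [f]
  have hfi : ∀ i, i ≠ r → f i = g i := fun i hi => by simp [f, hi]
  have hreach : ReachesRoot f r := by
    have : ∀ d i, T.dist i r = d → ∃ k : ℕ, f^[k] i = r := by
      intro d
      induction d using Nat.strong_induction_on with
      | _ d ih =>
        intro i hi
        by_cases hir : i = r
        · exact ⟨0, hir⟩
        · obtain ⟨k, hk⟩ := ih _ (hi ▸ (hg i hir).2) (g i) rfl
          exact ⟨k + 1, by rw [Function.iterate_succ_apply, hfi i hir, hk]⟩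
    exact fun i => this _ i rfl
  have hadj : ∀ i, i ≠ r → T.Adj i (f i) := fun i hi => hfi i hi ▸ (hg i hi).1
  refine ⟨f, hfr, hadj, hreach, ?_⟩
  have hle : parentGraph f ≤ T := by
    intro a b hab
    obtain ⟨hne, h | h⟩ := parentGraph_adj.mp hab
    · have : a ≠ r := by rintro rfl; exact hne (hfr.symm.trans h)
      exact h ▸ hadj a this
    · have : b ≠ r := by rintro rfl; exact hne (h.symm.trans hfr)
      exact h ▸ (hadj b this).symm
  exact le_antisymm hle
    ((SimpleGraph.isTree_iff_minimal_connected.mp hT).2 (connected_parentGraph hreach) hle)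

/-- The matrix-tree theorem: deleting the row and column of any vertex from the Laplacian (here by
replacing the row at `r` with a unit vector) leaves the number of spanning trees as determinant. -/
theorem numSpanningTrees_eq_det (G : SimpleGraph V) [DecidableRel G.Adj] (r : V) :
    (numSpanningTrees G : ℝ) = ((G.lapMatrix ℝ).updateRow r (Pi.single r 1)).det := by
  classical
  -- The single choice at `r` forces `f r = r`.
  let A : V → Finset V := fun i => if i = r then {r} else G.neighborFinset i
  let g : V → V → V → ℝ := fun i k =>
    if i = r then Pi.single r 1 else Pi.single i 1 - Pi.single k 1
  have hM : (G.lapMatrix ℝ).updateRow r (Pi.single r 1) = fun i => ∑ k ∈ A i, g i k := by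
    ext i j
    by_cases hi : i = r
    · subst hi; simp [A, g]
    · simp only [A, g, hi, if_false, Matrix.updateRow_ne hi,
        SimpleGraph.lapMatrix, SimpleGraph.degMatrix, Matrix.sub_apply, Matrix.diagonal_apply,
        SimpleGraph.adjMatrix_apply, Finset.sum_apply, Pi.sub_apply, Finset.sum_sub_distrib,
        Finset.sum_const, SimpleGraph.card_neighborFinset_eq_degree, Pi.single_apply,
        Finset.sum_ite_eq, SimpleGraph.mem_neighborFinset, nsmul_eq_mul]
      simp [eq_comm]
  have hdet : ((G.lapMatrix ℝ).updateRow r (Pi.single r 1)).det =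
      ∑ f ∈ Fintype.piFinset A, (parentMatrix f r).det := by
    rw [hM]
    exact (detRowAlternating (R := ℝ) (n := V)).toMultilinearMap.map_sum_finset g A
  have hA : ∀ f, f ∈ Fintype.piFinset A ↔ f r = r ∧ ∀ i, i ≠ r → G.Adj i (f i) := by
    intro f
    rw [Fintype.mem_piFinset]
    constructor
    · intro h
      refine ⟨by simpa [A] using h r, fun i hi => by simpa [A, hi] using h i⟩
    · rintro ⟨h1, h2⟩ i
      by_cases hi : i = r
      · subst hi; simpa [A] using h1
      · simpa [A, hi] using h2 i hi
  have hsum : ∑ f ∈ Fintype.piFinset A, (parentMatrix f r).det =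
      (((Fintype.piFinset A).filter fun f => ReachesRoot f r).card : ℝ) := by
    rw [Finset.card_filter, Nat.cast_sum]
    refine Finset.sum_congr rfl fun f _ => ?_
    split_ifs with h
    · rw [det_parentMatrix_of_reachesRoot h, Nat.cast_one]
    · rw [det_parentMatrix_of_not_reachesRoot h, Nat.cast_zero]
  rw [hdet, hsum]
  norm_cast
  unfold numSpanningTrees
  rw [← Set.ncard_coe_finset]
  have himg : {T : SimpleGraph V | T ≤ G ∧ T.IsTree} =
      parentGraph '' ((Fintype.piFinset A).filter fun f => ReachesRoot f r : Finset (V → V)) := by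
    ext T
    simp only [Set.mem_ofPred_eq, Set.mem_image, Finset.coe_filter, hA]
    constructor
    · rintro ⟨hle, hT⟩
      obtain ⟨f, h1, h2, h3, h4⟩ := exists_parentGraph_eq hT r
      exact ⟨f, ⟨⟨h1, fun i hi => hle (h2 i hi)⟩, h3⟩, h4⟩
    · rintro ⟨f, ⟨⟨h1, h2⟩, h3⟩, rfl⟩
      refine ⟨?_, isTree_parentGraph h1 h3⟩
      intro a b hab
      obtain ⟨hne, h | h⟩ := parentGraph_adj.mp hab
      · have : a ≠ r := by rintro rfl; exact hne (h1.symm.trans h)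
        exact h ▸ h2 a this
      · have : b ≠ r := by rintro rfl; exact hne (h.symm.trans h1)
        exact h ▸ (h2 b this).symm
  rw [himg]
  refine Set.InjOn.ncard_image ?_
  intro f hf g hg hfg
  simp only [Finset.coe_filter, Set.mem_ofPred_eq, hA] at hf hg
  exact parentGraph_injOn hf.1.1 hg.1.1 hf.2 hg.2 hfg

end RootedMaps

/-! ### Cofactors and determinants of circulant matrices -/

section Determinants

/-- If all rows of `A` other than the one at `r` are orthogonal to `x ≠ 0`, then replacing the row at
`r` by a vector orthogonal to `x` gives a singular matrix. -/
theorem det_updateRow_eq_zero {V : Type*} [Fintype V] [DecidableEq V] (A : Matrix V V ℝ) (r : V)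
    (x v : V → ℝ) (hx : x ≠ 0) (hA : ∀ i, i ≠ r → A i ⬝ᵥ x = 0) (hv : v ⬝ᵥ x = 0) :
    (A.updateRow r v).det = 0 := by
  refine exists_mulVec_eq_zero_iff.mp ⟨x, hx, ?_⟩
  ext i
  by_cases hi : i = r
  · subst hi; simpa [mulVec] using hv
  · simpa [mulVec, Matrix.updateRow_ne hi] using hA i hi

theorem det_updateRow_eq_of_dotProduct_eq {V : Type*} [Fintype V] [DecidableEq V]
    (A : Matrix V V ℝ) (r : V) (x v w : V → ℝ) (hx : x ≠ 0) (hA : ∀ i, i ≠ r → A i ⬝ᵥ x = 0)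
    (hv : v ⬝ᵥ x = w ⬝ᵥ x) : (A.updateRow r v).det = (A.updateRow r w).det := by
  have h := det_updateRow_eq_zero A r x (v - w) hx hA (by rw [sub_dotProduct, hv, sub_self])
  have h2 := det_updateRow_add A r (v - w) w
  rw [sub_add_cancel, h, zero_add] at h2
  exact h2

/-- For a matrix with vanishing row and column sums, adding a constant matrix produces, up to
scaling, a principal cofactor. -/
theorem det_add_const {V : Type*} [Fintype V] [DecidableEq V] (A : Matrix V V ℝ)
    (hrow : ∀ i, ∑ j, A i j = 0) (hcol : ∀ j, ∑ i, A i j = 0) (r : V) (c : ℝ) :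
    (A + Matrix.of fun _ _ => c).det =
      c * (Fintype.card V : ℝ) ^ 2 * (A.updateRow r (Pi.single r 1)).det := by
  set N : ℝ := (Fintype.card V : ℝ) with hN
  have hN0 : N ≠ 0 := by
    have : 0 < Fintype.card V := Fintype.card_pos_iff.mpr ⟨r⟩
    rw [hN]; exact_mod_cast this.ne'
  set M := A + Matrix.of fun _ _ => c with hM
  -- Add all the other rows to row `r`; the column sums of `A` vanish.
  have h1 : M.det = (M.updateRow r fun _ => c * N).det := by
    have h := det_updateRow_sum M r (fun _ => 1)
    rw [one_smul] at h
    rw [← h]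
    congr 2
    ext j
    have : (∑ k, (1 : ℝ) • M k) j = ∑ k, (A k j + c) := by
      rw [Finset.sum_apply]
      exact Finset.sum_congr rfl fun k _ => one_mul _
    rw [this, Finset.sum_add_distrib, hcol, zero_add, Finset.sum_const, card_univ, nsmul_eq_mul,
      hN, mul_comm]
  -- Subtracting `N⁻¹` times row `r` removes `c` from every other row.
  have h2 : (M.updateRow r fun _ => c * N).det = (A.updateRow r fun _ => c * N).det := by
    refine det_eq_of_forall_row_eq_smul_add_const (fun i => if i = r then 0 else N⁻¹) r
      (by simp) ?_
    intro i j
    by_cases hi : i = r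
    · subst hi; simp
    · simp [hi, Matrix.updateRow_ne, hM]
      field_simp
  have h3 : (A.updateRow r fun _ => c * N).det =
      (A.updateRow r ((c * N ^ 2) • Pi.single r 1)).det := by
    refine det_updateRow_eq_of_dotProduct_eq A r (fun _ => 1) _ _ ?_ ?_ ?_
    · intro h; simpa using congrFun h r
    · intro i _; simpa [dotProduct] using hrow i
    · rw [smul_dotProduct, single_one_dotProduct]
      simp [dotProduct, ← hN]
      ring
  rw [h1, h2, h3, det_updateRow_smul]

/-- The permutation matrix of the shift `i ↦ i + 1`. -/
def shiftMatrix (n : ℕ) : Matrix (Fin (n + 1)) (Fin (n + 1)) ℝ :=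
  Matrix.of fun i j => if j = i + 1 then 1 else 0

theorem det_updateRow_last_shiftMatrix (n : ℕ) (a : ℝ) :
    ((a • 1 - shiftMatrix n).updateRow (Fin.last n) (Pi.single (Fin.last n) 1)).det = a ^ n := by
  rw [det_of_isUpperTriangular]
  · rw [Fin.prod_univ_castSucc]
    have : ∀ i : Fin n, i.castSucc ≠ i.succ := fun i => (Fin.castSucc_lt_succ (i := i)).ne
    simp [Matrix.updateRow_ne, (Fin.castSucc_lt_last _).ne, shiftMatrix, this]
  · intro i j hij
    have hij : j < i := hij
    by_cases hi : i = Fin.last n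
    · subst hi; simp [hij.ne]
    · have h1 : i ≠ j := hij.ne'
      have h2 : j ≠ i + 1 := by
        have : i < i + 1 := Fin.lt_add_one_iff.mpr (Fin.lt_last_iff_ne_last.mpr hi)
        exact (hij.trans this).ne
      simp [Matrix.updateRow_ne hi, shiftMatrix, h1, h2]

theorem det_smul_one_sub_shiftMatrix (n : ℕ) {a : ℝ} (ha : a ≠ 0) :
    (a • 1 - shiftMatrix n).det = a ^ (n + 1) - 1 := by
  set A := a • 1 - shiftMatrix n with hA
  have hdot : ∀ (i : Fin (n + 1)) (x : Fin (n + 1) → ℝ), A i ⬝ᵥ x = a * x i - x (i + 1) := by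
    intro i x
    have : A i = a • Pi.single i 1 - Pi.single (i + 1) 1 := by
      ext j
      simp [hA, shiftMatrix, Matrix.one_apply, Pi.single_apply, eq_comm]
    rw [this, sub_dotProduct, smul_dotProduct]
    simp
  -- The geometric vector is killed by every row but the last, with which it pairs to `a ^ (n + 1) -
  -- 1`; its last entry is `a ^ n`.
  let x : Fin (n + 1) → ℝ := fun i => a ^ (i : ℕ)
  have h := det_updateRow_eq_of_dotProduct_eq A (Fin.last n) x (A (Fin.last n))
    (((a ^ (n + 1) - 1) / a ^ n) • Pi.single (Fin.last n) 1) ?_ ?_ ?_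
  · rw [updateRow_eq_self, det_updateRow_smul, hA, det_updateRow_last_shiftMatrix] at h
    rw [h]; field_simp
  · intro h; simpa [x] using congrFun h 0
  · intro i hi
    rw [hdot]
    have : ((i + 1 : Fin (n + 1)) : ℕ) = i + 1 := Fin.val_add_one_of_lt (Fin.lt_last_iff_ne_last.mpr hi)
    simp [x, this, pow_succ, mul_comm]
  · rw [hdot, smul_dotProduct]
    simp [x]; field_simp; ring

theorem shiftMatrix_mul_transpose (n : ℕ) : shiftMatrix n * (shiftMatrix n)ᵀ = 1 := by
  ext i j
  simp [shiftMatrix, Matrix.mul_apply, Matrix.one_apply, eq_comm]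

/-- The circulant matrix of the Laplacian of a cycle on `n + 1` vertices. -/
def cycleLap (n : ℕ) : Matrix (Fin (n + 1)) (Fin (n + 1)) ℝ :=
  (2 : ℝ) • 1 - shiftMatrix n - (shiftMatrix n)ᵀ

theorem det_smul_one_add_cycleLap (n : ℕ) {m a b : ℝ} (hab : a * b = 1) (hm : a + b = m + 2) :
    (m • 1 + cycleLap n).det = a ^ (n + 1) + b ^ (n + 1) - 2 := by
  have ha : a ≠ 0 := left_ne_zero_of_mul_eq_one hab
  have hfac : m • 1 + cycleLap n =
      (a • 1 - shiftMatrix n) * (b • (a • 1 - shiftMatrix n)ᵀ) := by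
    have : m = a + b - 2 := by linarith
    subst this
    simp only [cycleLap, transpose_sub, transpose_smul, transpose_one, smul_sub, smul_smul,
      sub_mul, mul_sub, Matrix.mul_smul, Matrix.smul_mul, mul_one, one_mul,
      shiftMatrix_mul_transpose]
    rw [mul_comm b a, hab]
    module
  rw [hfac, det_mul, det_smul, det_transpose, det_smul_one_sub_shiftMatrix n ha, Fintype.card_fin]
  have : a ^ (n + 1) * b ^ (n + 1) = 1 := by rw [← mul_pow, hab, one_pow]
  linear_combination (a ^ (n + 1) - 2) * this

theorem sum_shiftMatrix_row (n : ℕ) (i : Fin (n + 1)) : ∑ j, shiftMatrix n i j = 1 := by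
  simp [shiftMatrix]

theorem sum_shiftMatrix_col (n : ℕ) (j : Fin (n + 1)) : ∑ i, shiftMatrix n i j = 1 := by
  have : ∀ i : Fin (n + 1), (j = i + 1) = (i = j - 1) := by
    intro i; rw [eq_sub_iff_add_eq, @eq_comm _ j]
  simp [shiftMatrix, this]

theorem det_one_sub_shiftMatrix_add_const (n : ℕ) (c : ℝ) :
    ((1 : ℝ) • 1 - shiftMatrix n + Matrix.of fun _ _ => c).det = c * ((n : ℝ) + 1) ^ 2 := by
  rw [det_add_const _ _ _ (Fin.last n), det_updateRow_last_shiftMatrix]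
  · simp
  · intro i; simp [Finset.sum_sub_distrib, sum_shiftMatrix_row, Matrix.one_apply]
  · intro i; simp [Finset.sum_sub_distrib, sum_shiftMatrix_col, Matrix.one_apply]

/-- This is the degenerate case `a = b = 1` of the shift factorisation: constant matrices are
annihilated by `1 - S`, so the cross terms vanish. -/
theorem det_cycleLap_add_const (n : ℕ) (c : ℝ) :
    (cycleLap n + Matrix.of fun _ _ => c).det = c * ((n : ℝ) + 1) ^ 3 := by
  have hn : (n : ℝ) + 1 ≠ 0 := by positivity
  have hfac : cycleLap n + (Matrix.of fun _ _ => c) =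
      ((1 : ℝ) • 1 - shiftMatrix n + Matrix.of fun _ _ => (1 : ℝ)) *
        ((1 : ℝ) • 1 - shiftMatrix n + Matrix.of fun _ _ => c / (n + 1))ᵀ := by
    have h1 : shiftMatrix n * (Matrix.of fun _ _ => c / (n + 1) : Matrix _ (Fin (n + 1)) ℝ) =
        Matrix.of fun _ _ => c / (n + 1) := by
      ext i j
      simp [Matrix.mul_apply, ← Finset.sum_mul, sum_shiftMatrix_row]
    have h2 : (Matrix.of fun _ _ => (1 : ℝ) : Matrix (Fin (n + 1)) _ ℝ) * (shiftMatrix n)ᵀ =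
        Matrix.of fun _ _ => (1 : ℝ) := by
      ext i j
      simp [Matrix.mul_apply, sum_shiftMatrix_row]
    have h3 : (Matrix.of fun _ _ => (1 : ℝ) : Matrix (Fin (n + 1)) (Fin (n + 1)) ℝ) *
        (Matrix.of fun _ _ => c / (n + 1) : Matrix _ (Fin (n + 1)) ℝ) =
        Matrix.of fun _ _ => c := by
      ext i j
      simp [Matrix.mul_apply]
      field_simp
    have h4 : (Matrix.of fun _ _ => c / (n + 1) : Matrix (Fin (n + 1)) (Fin (n + 1)) ℝ)ᵀ =
        Matrix.of fun _ _ => c / (n + 1) := rfl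
    simp only [one_smul, transpose_add, transpose_sub, transpose_one, h4, add_mul, mul_add, sub_mul,
      mul_sub, one_mul, mul_one, h1, h2, h3, shiftMatrix_mul_transpose, cycleLap]
    module
  rw [hfac, det_mul, det_transpose, det_one_sub_shiftMatrix_add_const,
    det_one_sub_shiftMatrix_add_const]
  field_simp

end Determinants

/-! ### The Laplacian of the product of cycles -/

section Torus

theorem lapMatrix_boxProd {V W : Type*} [Fintype V] [DecidableEq V] [Fintype W] [DecidableEq W]
    (G : SimpleGraph V) (H : SimpleGraph W) [DecidableRel G.Adj] [DecidableRel H.Adj]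
    [DecidableRel (G.boxProd H).Adj] :
    (G.boxProd H).lapMatrix ℝ = G.lapMatrix ℝ ⊗ₖ 1 + 1 ⊗ₖ H.lapMatrix ℝ := by
  ext ⟨a, b⟩ ⟨c, d⟩
  simp only [SimpleGraph.lapMatrix, SimpleGraph.degMatrix, Matrix.sub_apply, Matrix.add_apply,
    Matrix.kroneckerMap_apply, Matrix.diagonal_apply, Matrix.one_apply,
    SimpleGraph.adjMatrix_apply, SimpleGraph.boxProd_adj, Prod.mk.injEq]
  rcases eq_or_ne a c with rfl | h1 <;> rcases eq_or_ne b d with rfl | h2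
  · simp only [SimpleGraph.irrefl, and_true, or_self, and_self, if_true, if_false, sub_zero,
      mul_one, one_mul]
    norm_cast
    convert SimpleGraph.degree_boxProd (G := G) (H := H) (a, b)
  · simp [h2]
  · simp [h1]
  · simp [h1, h2]

theorem lapMatrix_cycleGraph (k : ℕ) [DecidableRel (SimpleGraph.cycleGraph (k + 3)).Adj] :
    (SimpleGraph.cycleGraph (k + 3)).lapMatrix ℝ = cycleLap (k + 2) := by
  ext i j
  have hdeg : (SimpleGraph.cycleGraph (k + 3)).degree i = 2 := by
    rw [← SimpleGraph.cycleGraph_degree_three_le (v := i)]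
    congr!
  have hadj : (SimpleGraph.cycleGraph (k + 3)).Adj i j ↔ i = j + 1 ∨ j = i + 1 := by
    rw [SimpleGraph.cycleGraph_adj (n := k + 1), sub_eq_iff_eq_add', sub_eq_iff_eq_add']
  -- Length at least 3 makes the two neighbours of a vertex distinct.
  have hexcl : ¬ (i = j + 1 ∧ j = i + 1) := by
    rintro ⟨h1, h2⟩
    rw [h1, add_assoc, left_eq_add] at h2
    have := congrArg Fin.val h2
    rw [Fin.val_add] at this
    simp [Nat.mod_eq_of_lt (show 2 < k + 3 by omega)] at this
  simp only [SimpleGraph.lapMatrix, SimpleGraph.degMatrix, Matrix.sub_apply,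
    Matrix.diagonal_apply, SimpleGraph.adjMatrix_apply, hadj, hdeg, cycleLap, shiftMatrix,
    Matrix.smul_apply, Matrix.one_apply, Matrix.transpose_apply, Matrix.of_apply]
  by_cases h1 : i = j + 1
  · have h2 : ¬ j = i + 1 := fun h2 => hexcl ⟨h1, h2⟩
    rw [if_pos (Or.inl h1), if_neg h2, if_pos h1]
    split_ifs <;> simp
  · by_cases h2 : j = i + 1
    · rw [if_pos (Or.inr h2), if_neg h1, if_pos h2]
      split_ifs <;> simp
    · simp [h1, h2]

theorem det_diagonal_kronecker_add {m n : Type*} [Fintype m] [DecidableEq m] [Fintype n]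
    [DecidableEq n] (d e : m → ℝ) (L J : Matrix n n ℝ) :
    (diagonal d ⊗ₖ (1 : Matrix n n ℝ) + 1 ⊗ₖ L + diagonal e ⊗ₖ J).det =
      ∏ i, (d i • 1 + L + e i • J).det := by
  rw [← diagonal_one (n := m), diagonal_kronecker, diagonal_kronecker, diagonal_kronecker,
    ← det_blockDiagonal, ← det_reindex_self (Equiv.prodComm n m)]
  congr 1
  ext ⟨a, b⟩ ⟨c, d⟩
  by_cases h : a = c <;> simp [h, blockDiagonal_apply]

/-- An eigenbasis of the Laplacian of the 4-cycle, written as rows. -/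
def fourCycleBasis : Matrix (Fin 4) (Fin 4) ℝ :=
  !![1, 1, 1, 1; 1, -1, 1, -1; 1, 0, -1, 0; 0, 1, 0, -1]

theorem det_fourCycleBasis_ne_zero : fourCycleBasis.det ≠ 0 := by
  refine det_ne_zero_of_right_inverse (B := !![1/4, 1/4, 1/2, 0; 1/4, -1/4, 0, 1/2;
    1/4, 1/4, -1/2, 0; 1/4, -1/4, 0, -1/2]) ?_
  ext i j
  fin_cases i <;> fin_cases j <;>
    simp [fourCycleBasis, Matrix.mul_apply, Fin.sum_univ_four] <;> norm_num

theorem cycleLap_three : cycleLap 3 = !![2, -1, 0, -1; -1, 2, -1, 0; 0, -1, 2, -1; -1, 0, -1, 2] := by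
  ext i j
  fin_cases i <;> fin_cases j <;> simp [cycleLap, shiftMatrix]

theorem fourCycleBasis_mul_cycleLap :
    fourCycleBasis * cycleLap 3 = diagonal ![0, 4, 2, 2] * fourCycleBasis := by
  rw [cycleLap_three]
  ext i j
  fin_cases i <;> fin_cases j <;>
    simp [fourCycleBasis, Matrix.mul_apply, Fin.sum_univ_four] <;> norm_num

theorem fourCycleBasis_mul_const :
    fourCycleBasis * (Matrix.of fun _ _ => 1) = diagonal ![4, 0, 0, 0] * fourCycleBasis := by
  ext i j
  fin_cases i <;> fin_cases j <;>
    simp [fourCycleBasis, Matrix.mul_apply, Fin.sum_univ_four] <;> norm_num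

/-- The rows of `fourCycleBasis` are common left eigenvectors of `cycleLap 3` and the 4 × 4 all-ones
matrix. The latter has eigenvalue 4 on the constant row and 0 elsewhere, so the correction survives
only in the singular block. -/
theorem det_torus (n : ℕ) :
    (cycleLap 3 ⊗ₖ 1 + 1 ⊗ₖ cycleLap n + Matrix.of fun _ _ => (1 : ℝ)).det =
      (cycleLap n + Matrix.of fun _ _ => (4 : ℝ)).det *
        (((4 : ℝ) • 1 + cycleLap n).det * ((2 : ℝ) • 1 + cycleLap n).det ^ 2) := by
  let J : Matrix (Fin (n + 1)) (Fin (n + 1)) ℝ := Matrix.of fun _ _ => 1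
  let J₄ : Matrix (Fin 4) (Fin 4) ℝ := Matrix.of fun _ _ => 1
  have hJ : (Matrix.of fun _ _ => (1 : ℝ) : Matrix (Fin 4 × Fin (n + 1)) _ ℝ) = J₄ ⊗ₖ J := by
    ext; simp [J, J₄]
  have h4 : (Matrix.of fun _ _ => (4 : ℝ) : Matrix (Fin (n + 1)) (Fin (n + 1)) ℝ) = (4 : ℝ) • J := by
    ext; simp [J]
  have hconj : (fourCycleBasis ⊗ₖ (1 : Matrix (Fin (n + 1)) (Fin (n + 1)) ℝ)) *
      (cycleLap 3 ⊗ₖ 1 + 1 ⊗ₖ cycleLap n + J₄ ⊗ₖ J) =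
      (diagonal ![0, 4, 2, 2] ⊗ₖ 1 + 1 ⊗ₖ cycleLap n + diagonal ![4, 0, 0, 0] ⊗ₖ J) *
        (fourCycleBasis ⊗ₖ 1) := by
    simp only [mul_add, add_mul, ← mul_kronecker_mul, one_mul, mul_one, J₄,
      fourCycleBasis_mul_cycleLap, fourCycleBasis_mul_const]
  have hdet : (fourCycleBasis ⊗ₖ (1 : Matrix (Fin (n + 1)) (Fin (n + 1)) ℝ)).det ≠ 0 := by
    rw [det_kronecker, det_one, one_pow, mul_one]
    exact pow_ne_zero _ det_fourCycleBasis_ne_zero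
  have h := congrArg det hconj
  rw [det_mul, det_mul, mul_comm] at h
  rw [hJ, mul_right_cancel₀ hdet h, det_diagonal_kronecker_add, Fin.prod_univ_four, h4]
  simp
  ring

theorem sum_lapMatrix_row {V : Type*} [Fintype V] [DecidableEq V] (G : SimpleGraph V)
    [DecidableRel G.Adj] (i : V) : ∑ j, G.lapMatrix ℝ i j = 0 := by
  have := congrFun (G.lapMatrix_mulVec_const_eq_zero (R := ℝ)) i
  simpa [mulVec, dotProduct] using this

theorem numSpanningTrees_torus (k : ℕ) {a b c d : ℝ} (hab : a * b = 1) (hab' : a + b = 4)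
    (hcd : c * d = 1) (hcd' : c + d = 6) :
    (numSpanningTrees (SimpleGraph.boxProd (SimpleGraph.cycleGraph 4)
      (SimpleGraph.cycleGraph (k + 3))) : ℝ) =
      ((k + 3 : ℕ) : ℝ) / 4 * (a ^ (k + 3) + b ^ (k + 3) - 2) ^ 2 *
        (c ^ (k + 3) + d ^ (k + 3) - 2) := by
  classical
  set G := SimpleGraph.boxProd (SimpleGraph.cycleGraph 4) (SimpleGraph.cycleGraph (k + 3)) with hG
  have h1 := det_add_const (G.lapMatrix ℝ) (sum_lapMatrix_row G)
    (fun j => by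
      rw [← sum_lapMatrix_row G j]
      exact Finset.sum_congr rfl fun i _ => (G.isSymm_lapMatrix (R := ℝ)).apply j i) (0, 0) 1
  rw [← numSpanningTrees_eq_det] at h1
  have h2 : G.lapMatrix ℝ = cycleLap 3 ⊗ₖ 1 + 1 ⊗ₖ cycleLap (k + 2) := by
    rw [hG, lapMatrix_boxProd, lapMatrix_cycleGraph k, lapMatrix_cycleGraph 1]
  rw [h2, det_torus, det_cycleLap_add_const,
    det_smul_one_add_cycleLap _ hab (show a + b = 2 + 2 by linarith),
    det_smul_one_add_cycleLap _ hcd (show c + d = 4 + 2 by linarith)] at h1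
  simp only [Fintype.card_prod, Fintype.card_fin, one_mul] at h1
  push_cast at h1 ⊢
  have hk : (k : ℝ) + 3 ≠ 0 := by positivity
  refine mul_left_cancel₀ (pow_ne_zero 2 (mul_ne_zero (four_ne_zero' ℝ) hk)) (h1.symm.trans ?_)
  ring

end Torus

/-! ### Lucas terms at half-integer index -/

section LucasSequences

theorem lucasAlpha_mul_lucasBeta (m : ℕ) : lucasAlpha m * lucasBeta m = 1 := by
  have h := Real.mul_self_sqrt (show (0 : ℝ) ≤ (m : ℝ) ^ 2 + 4 * m by positivity)
  unfold lucasAlpha lucasBeta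
  linear_combination (-1 / 4) * h

theorem lucasAlpha_add_lucasBeta (m : ℕ) : lucasAlpha m + lucasBeta m = m + 2 := by
  unfold lucasAlpha lucasBeta
  ring

theorem lucasAlpha_pos (m : ℕ) : 0 < lucasAlpha m := by
  unfold lucasAlpha
  positivity

theorem lucasBeta_pos (m : ℕ) : 0 < lucasBeta m :=
  pos_of_mul_pos_right (lucasAlpha_mul_lucasBeta m ▸ one_pos) (lucasAlpha_pos m).le

theorem lucasAlpha_sub_lucasBeta_sq (m : ℕ) :
    (lucasAlpha m - lucasBeta m) ^ 2 = (m : ℝ) ^ 2 + 4 * m := by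
  linear_combination (lucasAlpha m + lucasBeta m + m + 2) * lucasAlpha_add_lucasBeta m -
    4 * lucasAlpha_mul_lucasBeta m

/-- The square of `u_{n/2}(m)`, cleared of denominators. -/
theorem lucasU_half_sq (n m : ℕ) (hm : 0 < m) :
    ((m : ℝ) ^ 2 + 4 * m) * lucasU ((n : ℝ) / 2) m ^ 2 =
      lucasAlpha m ^ n + lucasBeta m ^ n - 2 := by
  have hpow : ∀ x : ℝ, 0 < x → (x ^ ((n : ℝ) / 2)) ^ 2 = x ^ n := by
    intro x hx
    rw [← Real.rpow_natCast, ← Real.rpow_mul hx.le]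
    norm_num
  have hmul : lucasAlpha m ^ ((n : ℝ) / 2) * lucasBeta m ^ ((n : ℝ) / 2) = 1 := by
    rw [← Real.mul_rpow (lucasAlpha_pos m).le (lucasBeta_pos m).le, lucasAlpha_mul_lucasBeta,
      Real.one_rpow]
  have hsq := lucasAlpha_sub_lucasBeta_sq m
  have hne : lucasAlpha m - lucasBeta m ≠ 0 := by
    intro h
    rw [h] at hsq
    have : (0 : ℝ) < (m : ℝ) ^ 2 + 4 * m := by positivity
    simp at hsq
    linarith
  rw [← hsq, lucasU, mul_pow, ← mul_assoc, ← mul_pow, mul_one_div_cancel hne, one_pow, one_mul,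
    ← hpow _ (lucasAlpha_pos m), ← hpow _ (lucasBeta_pos m)]
  linear_combination (-2) * hmul

end LucasSequences

/-- When `a` and `b` are `(s + 1)² / q` and `(s - 1)² / q` with `q = s² - 1`, the number
`aⁿ + bⁿ - 2` is a square divided by `qⁿ`. -/
theorem sq_pow_sub_pow (n : ℕ) {s a b q : ℝ} (hq : q ≠ 0) (ha : (s + 1) ^ 2 = q * a)
    (hb : (s - 1) ^ 2 = q * b) (hs : (s + 1) * (s - 1) = q) :
    a ^ n + b ^ n - 2 = ((s + 1) ^ n - (s - 1) ^ n) ^ 2 / q ^ n := by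
  have h1 : ((s + 1) ^ n) ^ 2 = q ^ n * a ^ n := by rw [← pow_mul, mul_comm, pow_mul, ha, mul_pow]
  have h2 : ((s - 1) ^ n) ^ 2 = q ^ n * b ^ n := by rw [← pow_mul, mul_comm, pow_mul, hb, mul_pow]
  have h3 : (s + 1) ^ n * (s - 1) ^ n = q ^ n := by rw [← mul_pow, hs]
  have : q ^ n ≠ 0 := pow_ne_zero _ hq
  field_simp
  linear_combination (-1) * h1 - h2 + 2 * h3

theorem theorem5p3 (n : ℕ) (hn : 3 ≤ n) :
    (numSpanningTrees (SimpleGraph.boxProd (SimpleGraph.cycleGraph 4) (SimpleGraph.cycleGraph n)) : ℝ)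
        = 2 ^ 7 * 3 ^ 2 * (n : ℝ) * eSeq ((n : ℝ) / 2) ^ 4 * fSeq ((n : ℝ) / 2) ^ 2 ∧
    (numSpanningTrees (SimpleGraph.boxProd (SimpleGraph.cycleGraph 4) (SimpleGraph.cycleGraph n)) : ℝ)
        = (n : ℝ) / 4 ^ (n + 1)
          * ((Real.sqrt 3 + 1) ^ n - (Real.sqrt 3 - 1) ^ n) ^ 4
          * ((Real.sqrt 2 + 1) ^ n - (Real.sqrt 2 - 1) ^ n) ^ 2 := by
  obtain ⟨k, rfl⟩ := Nat.exists_eq_add_of_le' hn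
  constructor
  -- Here `m² + 4m` is 12 and 32, and `12² * 32 / 4 = 2⁷ * 3²`.
  · have he := lucasU_half_sq (k + 3) 2 two_pos
    have hf := lucasU_half_sq (k + 3) 4 four_pos
    rw [numSpanningTrees_torus k (lucasAlpha_mul_lucasBeta 2)
      ((lucasAlpha_add_lucasBeta 2).trans (by norm_num)) (lucasAlpha_mul_lucasBeta 4)
      ((lucasAlpha_add_lucasBeta 4).trans (by norm_num)), ← he, ← hf, eSeq, fSeq]
    push_cast
    ring
  · have h3 : Real.sqrt 3 ^ 2 = 3 := Real.sq_sqrt (by norm_num)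
    have h2 : Real.sqrt 2 ^ 2 = 2 := Real.sq_sqrt (by norm_num)
    -- These values satisfy `2 ± √3 = (√3 ± 1)² / 2` and `3 ± 2√2 = (√2 ± 1)²`.
    rw [numSpanningTrees_torus k (a := 2 + Real.sqrt 3) (b := 2 - Real.sqrt 3)
      (c := 3 + 2 * Real.sqrt 2) (d := 3 - 2 * Real.sqrt 2) (by linear_combination -h3) (by ring)
      (by linear_combination (-4) * h2) (by ring),
      sq_pow_sub_pow (k + 3) (s := Real.sqrt 3) (q := 2) two_ne_zero (by linear_combination h3)
        (by linear_combination h3) (by linear_combination h3),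
      sq_pow_sub_pow (k + 3) (s := Real.sqrt 2) (q := 1) one_ne_zero (by linear_combination h2)
        (by linear_combination h2) (by linear_combination h2)]
    have h4 : (4 : ℝ) ^ (k + 3 + 1) = 4 * (2 ^ (k + 3)) ^ 2 := by
      rw [pow_succ, ← pow_mul, mul_comm (k + 3) 2, pow_mul]
      norm_num
      ring
    rw [h4, one_pow]
    field_simp
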